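/- Let $G$ be a topological group. A compact metric $G$-system is a compact metric space $X$ with a continuous action $G\times X\to X$; a $G$-map is a continuous $G$-equivariant map. A sequence $f_n:X\to\mathbb R$ is independent if there are reals $a<b$ such that $\bigcap_{n\in P}f_n^{-1}(-\infty,a)\cap\bigcap_{n\in M}f_n^{-1}(b,\infty)\neq\emptyset$ for all finite disjoint $P,M\subset\mathbb N$. The system $X$ is tame if for every continuous $f:X\to\mathbb R$ the family $fG=\{fg: g\in G\}$, where $(fg)(x)=f(gx)$, contains no independent sequence. The enveloping semigroup $E(X)$ is the closure of the set of translations $x\mapsto gx$ ($g\in G$) in $X^X$ with the topology of pointwise convergence. The system is equicontinuous if its translations form an equicontinuous family. A surjective $G$-map $\pi:X\to Y$ is a strongly almost 1-1 extension if $X\setminus X_0$ is at most countable, where $X_0=\{x\in X: |\pi^{-1}(\pi(x))|=1\}$. A $G$-map $\pi:X\to Y$ (not necessarily onto) is a strong almost 1-1 equivalence if there are at most countable sets $X_1\subset X$, $Y_1\subset Y$ such that $\pi$ restricts to a bijection $X\setminus X_1\to Y\setminus Y_1$. Theorem. Let $X,Y$ be compact metric $G$-systems. (1) Let $\pi:X\to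 Y$ be a strongly almost 1-1 extension. If $Y$ is tame and $p^{-1}(y)$ is at most countable for every $p\in E(Y)$ and every $y\in Y$, then $X$ is tame. (2) Let $\pi:X\to Y$ be a strong almost 1-1 equivalence. If $Y$ is equicontinuous, then $X$ is tame. -/

import Mathlib

namespace TameSystems

/-- A sequence of real valued functions on a set is *independent* if for some reals `a < b`
all finite disjoint `P, M` satisfy
`⋂ n ∈ P, f n ⁻¹ (-∞, a) ∩ ⋂ n ∈ M, f n ⁻¹ (b, ∞) ≠ ∅`. -/
def IsIndependentSeq {X : Type*} (f : ℕ → X → ℝ) : Prop :=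
  ∃ a b : ℝ, a < b ∧ ∀ P M : Finset ℕ, Disjoint P M →
    ((⋂ n ∈ P, f n ⁻¹' Set.Iio a) ∩ (⋂ n ∈ M, f n ⁻¹' Set.Ioi b)).Nonempty

/-- A (bounded) family of real valued functions on a set is *tame* if it contains no independent
sequence. -/
def IsTameFamily {X : Type*} (F : Set (X → ℝ)) : Prop :=
  ¬ ∃ f : ℕ → X → ℝ, (∀ n, f n ∈ F) ∧ IsIndependentSeq f

/-- The orbit `fG = {fg : g ∈ G}`, where `(fg)(x) = f (g x)`. -/
def orbitFamily (G : Type*) {X : Type*} [Group G] [MulAction G X] (f : X → ℝ) : Set (X → ℝ) :=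
  Set.range fun (g : G) (x : X) => f (g • x)

/-- A compact `G`-system `X` is *tame* if `fG` contains no independent sequence, for every
continuous real function `f` on `X`. -/
def IsTame (G X : Type*) [Group G] [TopologicalSpace X] [MulAction G X] : Prop :=
  ∀ f : C(X, ℝ), IsTameFamily (orbitFamily G (f : X → ℝ))

/-- The *enveloping semigroup* `E(G, X)`: the pointwise closure in `X ^ X` of the set of
translations `x ↦ g x`. -/
def envelopingSemigroup (G X : Type*) [Group G] [TopologicalSpace X] [MulAction G X] :
    Set (X → X) :=
  closure (Set.range fun (g : G) (x : X) => g • x)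

/-- A *`G`-map* (homomorphism of `G`-systems): a continuous equivariant map. -/
structure IsGMap (G : Type*) {X Y : Type*} [Group G] [TopologicalSpace X] [TopologicalSpace Y]
    [MulAction G X] [MulAction G Y] (π : X → Y) : Prop where
  continuous : Continuous π
  map_smul : ∀ (g : G) (x : X), π (g • x) = g • π x

/-- The set `X₀` of the points `x` of `X` with `|π⁻¹(π(x))| = 1`. -/
def singletonFibrePart {X Y : Type*} (π : X → Y) : Set X :=
  {x | (π ⁻¹' {π x}).encard = 1}

/-- A *strongly almost 1-1 extension*: a surjective `G`-map such that `X \ X₀` is at most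
countable. -/
structure IsStronglyAlmostOneOneExtension (G : Type*) {X Y : Type*} [Group G]
    [TopologicalSpace X] [TopologicalSpace Y] [MulAction G X] [MulAction G Y] (π : X → Y) :
    Prop where
  isGMap : IsGMap G π
  surjective : Function.Surjective π
  countable : (singletonFibrePart π)ᶜ.Countable

/-- A *strong almost 1-1 equivalence*: a `G`-map, not necessarily onto, which for some (at most)
countable `X₁ ⊆ X`, `Y₁ ⊆ Y` restricts to a bijection `X \ X₁ → Y \ Y₁`. -/
structure IsStrongAlmostOneOneEquivalence (G : Type*) {X Y : Type*} [Group G]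
    [TopologicalSpace X] [TopologicalSpace Y] [MulAction G X] [MulAction G Y] (π : X → Y) :
    Prop where
  isGMap : IsGMap G π
  exists_countable : ∃ (X₁ : Set X) (Y₁ : Set Y), X₁.Countable ∧ Y₁.Countable ∧
    Set.BijOn π X₁ᶜ Y₁ᶜ

/-- A `G`-system is *equicontinuous* if its translations form an equicontinuous family. -/
def IsEquicontinuousSystem (G Y : Type*) [Group G] [UniformSpace Y] [MulAction G Y] : Prop :=
  Equicontinuous fun (g : G) (y : Y) => g • y

end TameSystems

/-! Both parts reduce to `IsGMap.isTame_of_countable_fibres`. Suppose the functions `f (g n • ·)`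
are independent on `X`, and pass to a subsequence along which the translations of `Y` converge
pointwise to `p`. By compactness every pattern of low and high values is realised by a point, so
each `T : Set ℕ` can be coded by a point `x T` along whose orbit `f` also oscillates. The orbit of
`x T` therefore diverges, which forces the fibre over `p (π (x T))` to have several points.
Countability of the set of such fibres, of the fibres of `p` and of those of `π` leaves only
countably many candidates for `x T`, against Cantor. The convergent subsequence comes from
Rosenthal's dichotomy when `Y` is tame, and from Arzelà–Ascoli when `Y` is equicontinuous; in the
latter case `p` is injective. -/

namespace TameSystems

open Filter Topology

/-! ### Nash-Williams partition theorem via ultrafilter games -/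

section Ramsey

/-- Diagonalisation along a non-principal ultrafilter: an increasing sequence each of whose terms
lies in all the prescribed sets attached to increasing lists of earlier terms. -/
theorem exists_strictMono_forall_list_mem (U : Ultrafilter ℕ) (hU : (U : Filter ℕ) ≤ atTop)
    (σ : List ℕ → Set ℕ) (hσ : ∀ l, σ l ∈ U) :
    ∃ m : ℕ → ℕ, StrictMono m ∧ ∀ (l : List ℕ) (n : ℕ), l.Pairwise (· < ·) →
      (∀ i ∈ l, i < n) → m n ∈ σ (l.map m) := by
  have key : ∀ k : ℕ, ∃ n, k < n ∧
      ∀ s ∈ (Finset.range (k + 1)).powerset, n ∈ σ (s.sort (· ≤ ·)) := by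
    intro k
    have h1 : ∀ᶠ n in (U : Filter ℕ), k < n := hU (eventually_gt_atTop k)
    have h2 : ∀ᶠ n in (U : Filter ℕ), ∀ s ∈ (Finset.range (k + 1)).powerset,
        n ∈ σ (s.sort (· ≤ ·)) := by
      rw [Filter.eventually_all_finset]
      exact fun s _ => hσ _
    exact (h1.and h2).exists
  choose next hlt hmem using key
  -- `m (n + 1) = next (m n)`, and every increasing list of earlier terms is the sorted form of a
  -- subset of `range (m n + 1)`.
  let m : ℕ → ℕ := fun n => next^[n + 1] 0
  have hm : ∀ n, m n = next (next^[n] 0) := fun n => Function.iterate_succ_apply' next n 0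
  have hmono : StrictMono m := strictMono_nat_of_lt_succ fun n => by
    rw [hm (n + 1)]; exact hlt _
  refine ⟨m, hmono, fun l n hl hn => ?_⟩
  have hsorted : (l.map m).Pairwise (· < ·) := List.pairwise_map.2 (hl.imp fun h => hmono h)
  have hsort : (l.map m).toFinset.sort (· ≤ ·) = l.map m :=
    (List.toFinset_sort (· ≤ ·) (hsorted.imp fun h => h.ne)).2 (hsorted.imp fun h => h.le)
  rw [hm n, ← hsort]
  refine hmem _ _ (Finset.mem_powerset.2 fun x hx => ?_)
  obtain ⟨i, hi, rfl⟩ := List.mem_map.1 (List.mem_toFinset.1 hx)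
  have hin := hn i hi
  obtain ⟨j, rfl⟩ : ∃ j, n = j + 1 := ⟨n - 1, by omega⟩
  have : m i ≤ m j := hmono.monotone (by omega)
  exact Finset.mem_range.2 (Nat.lt_succ_of_le this)

/-- A family of finite sequences is a *`U`-bar* if there is a strategy with moves in `U` such that
every infinite sequence following the strategy has an initial segment in the family. -/
def IsUltrafilterBar (U : Ultrafilter ℕ) (F : Set (List ℕ)) : Prop :=
  ∃ σ : List ℕ → Set ℕ, (∀ l, σ l ∈ U) ∧
    ∀ x : ℕ → ℕ, (∀ k, x k ∈ σ ((List.range k).map x)) → ∃ k, (List.range k).map x ∈ F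

theorem isUltrafilterBar_of_nil_mem (U : Ultrafilter ℕ) {F : Set (List ℕ)} (h : [] ∈ F) :
    IsUltrafilterBar U F :=
  ⟨fun _ => Set.univ, fun _ => univ_mem, fun _ _ => ⟨0, by simpa using h⟩⟩

theorem map_range_succ_eq_cons (x : ℕ → ℕ) (k : ℕ) :
    (List.range (k + 1)).map x = x 0 :: (List.range k).map fun i => x (i + 1) := by
  rw [List.range_succ_eq_map]
  simp [Function.comp_def]

/-- Play a first move `n` for which a strategy on the tails exists, then follow that strategy. -/
theorem isUltrafilterBar_of_eventually (U : Ultrafilter ℕ) {F : Set (List ℕ)}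
    (h : ∀ᶠ n in (U : Filter ℕ), IsUltrafilterBar U {l | n :: l ∈ F}) :
    IsUltrafilterBar U F := by
  classical
  have hex : ∀ n, ∃ σ : List ℕ → Set ℕ, (∀ l, σ l ∈ U) ∧
      (IsUltrafilterBar U {l | n :: l ∈ F} →
        ∀ x : ℕ → ℕ, (∀ k, x k ∈ σ ((List.range k).map x)) →
          ∃ k, n :: (List.range k).map x ∈ F) := by
    intro n
    by_cases hn : IsUltrafilterBar U {l | n :: l ∈ F}
    · obtain ⟨σ, h1, h2⟩ := hn
      exact ⟨σ, h1, fun _ => h2⟩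
    · exact ⟨fun _ => Set.univ, fun _ => univ_mem, fun h => absurd h hn⟩
  choose τ hτ hbar using hex
  let σ : List ℕ → Set ℕ
    | [] => {n | IsUltrafilterBar U {l | n :: l ∈ F}}
    | n :: l => τ n l
  refine ⟨σ, ?_, fun x hx => ?_⟩
  · rintro (_ | ⟨n, l⟩)
    · exact h
    · exact hτ n l
  · have h0 : IsUltrafilterBar U {l | x 0 :: l ∈ F} := hx 0
    obtain ⟨k, hk⟩ := hbar (x 0) h0 (fun i => x (i + 1)) fun k => by
      have := hx (k + 1)
      rwa [map_range_succ_eq_cons] at this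
    exact ⟨k + 1, by rwa [map_range_succ_eq_cons]⟩

/-- The Nash-Williams partition theorem: for each family `F` of finite sequences some increasing
sequence either has no finite subsequence in `F`, or has the property that all its infinite
subsequences have an initial segment in `F`. -/
theorem exists_strictMono_forall_notMem_or_forall_exists_mem (F : Set (List ℕ)) :
    ∃ m : ℕ → ℕ, StrictMono m ∧
      ((∀ l : List ℕ, l.Pairwise (· < ·) → l.map m ∉ F) ∨
        ∀ i : ℕ → ℕ, StrictMono i → ∃ k, (List.range k).map (m ∘ i) ∈ F) := by
  let U : Ultrafilter ℕ := Ultrafilter.of atTop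
  have hU : (U : Filter ℕ) ≤ atTop := Ultrafilter.of_le _
  by_cases hF : IsUltrafilterBar U F
  · obtain ⟨σ, hσ, hbar⟩ := hF
    obtain ⟨m, hm, hmσ⟩ := exists_strictMono_forall_list_mem U hU σ hσ
    refine ⟨m, hm, Or.inr fun i hi => hbar (m ∘ i) fun k => ?_⟩
    have := hmσ ((List.range k).map i) (i k)
      (List.pairwise_map.2 (List.pairwise_lt_range.imp fun h => hi h))
      (by simpa using fun j hj => hi hj)
    simpa using this
  -- Not being a bar is inherited by `U`-almost every one-term extension, so the diagonal sequence
  -- preserves it.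
  · let σ : List ℕ → Set ℕ := fun l => {n | ¬ IsUltrafilterBar U {t | l ++ t ∈ F} →
      ¬ IsUltrafilterBar U {t | (l ++ [n]) ++ t ∈ F}}
    have hσ : ∀ l, σ l ∈ U := by
      intro l
      by_cases hl : IsUltrafilterBar U {t | l ++ t ∈ F}
      · exact mem_of_superset univ_mem fun n _ h => absurd hl h
      · have h1 : ¬ ∀ᶠ n in (U : Filter ℕ),
            IsUltrafilterBar U {t | (l ++ [n]) ++ t ∈ F} := fun h =>
          hl (isUltrafilterBar_of_eventually U (by simpa using h))
        have h2 := Ultrafilter.eventually_not.2 h1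
        exact mem_of_superset h2 fun n hn _ => hn
    obtain ⟨m, hm, hmσ⟩ := exists_strictMono_forall_list_mem U hU σ hσ
    have hnot : ∀ l : List ℕ, l.Pairwise (· < ·) →
        ¬ IsUltrafilterBar U {t | l.map m ++ t ∈ F} := by
      intro l
      induction l using List.reverseRecOn with
      | nil => intro _; simpa using hF
      | append_singleton l n ih =>
        intro hl
        rw [List.pairwise_append] at hl
        have := hmσ l n hl.1 (fun i hi => hl.2.2 i hi n (by simp)) (ih hl.1)
        simpa using this
    exact ⟨m, hm, Or.inl fun l hl hmem =>
      hnot l hl (isUltrafilterBar_of_nil_mem U (by simpa using hmem))⟩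

end Ramsey

/-! ### Rosenthal's dichotomy and diagonal subsequences -/

section Rosenthal

variable {S : Type*}

/-- The intersection of the sets indexed by a list, taken alternately from `A` and from `B`,
starting with `A` if the Boolean is `true`. -/
def alternatingInter (A B : ℕ → Set S) : Bool → List ℕ → Set S
  | _, [] => Set.univ
  | true, n :: l => A n ∩ alternatingInter A B false l
  | false, n :: l => B n ∩ alternatingInter A B true l

theorem mem_alternatingInter_map_range {A B : ℕ → Set S} {x : S} (k : ℕ) :
    ∀ (b : Bool) (i : ℕ → ℕ),
      (∀ j, if (j % 2 = 0 ↔ b = true) then x ∈ A (i j) else x ∈ B (i j)) →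
      x ∈ alternatingInter A B b ((List.range k).map i) := by
  induction k with
  | zero => intro b i _; simp [alternatingInter]
  | succ k ih =>
    intro b i h
    rw [map_range_succ_eq_cons]
    have h0 := h 0
    have hs : ∀ j, if (j % 2 = 0 ↔ (!b) = true) then x ∈ A (i (j + 1)) else x ∈ B (i (j + 1)) := by
      intro j
      have hj := h (j + 1)
      rcases Nat.mod_two_eq_zero_or_one j with h2 | h2 <;> cases b <;>
        simp_all [Nat.add_mod]
    cases b
    · exact ⟨by simpa using h0, ih true _ hs⟩
    · exact ⟨by simpa using h0, ih false _ hs⟩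

/-- Alternation can imitate any pattern `w`: the odd position `2 * k + 1` carries the choice for
`k`, and the even position `2 * k` is inserted only when the parity has to be shifted. -/
theorem exists_list_alternatingInter_subset (A B : ℕ → Set S) (m : ℕ → ℕ) (w : ℕ → Prop) (N : ℕ) :
    ∀ (k₀ : ℕ) (b : Bool), ∃ l : List ℕ, l.Pairwise (· < ·) ∧ (∀ i ∈ l, 2 * k₀ ≤ i) ∧
      ∀ x ∈ alternatingInter A B b (l.map m), ∀ k, k₀ ≤ k → k < k₀ + N →
        (w k → x ∈ A (m (2 * k + 1))) ∧ (¬ w k → x ∈ B (m (2 * k + 1))) := by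
  induction N with
  | zero => exact fun k₀ b => ⟨[], by simp, by simp, fun x _ k h1 h2 => by omega⟩
  | succ N ih =>
    intro k₀ b
    by_cases hb : w k₀ ↔ b = true
    · obtain ⟨l, hl, hge, hx⟩ := ih (k₀ + 1) (!b)
      refine ⟨(2 * k₀ + 1) :: l, List.pairwise_cons.2 ⟨fun i hi => ?_, hl⟩, ?_, ?_⟩
      · have := hge i hi; omega
      · intro i hi
        rcases List.mem_cons.1 hi with rfl | hi
        · omega
        · have := hge i hi; omega
      · intro x hmem k h1 h2
        rcases h1.eq_or_lt with rfl | h1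
        · cases b <;> simp_all [alternatingInter]
        · refine hx x ?_ k h1 (by omega)
          cases b
          · exact hmem.2
          · exact hmem.2
    · obtain ⟨l, hl, hge, hx⟩ := ih (k₀ + 1) b
      refine ⟨(2 * k₀) :: (2 * k₀ + 1) :: l, ?_, ?_, ?_⟩
      · refine List.pairwise_cons.2 ⟨fun i hi => ?_, List.pairwise_cons.2 ⟨fun i hi => ?_, hl⟩⟩
        · rcases List.mem_cons.1 hi with rfl | hi
          · omega
          · have := hge i hi; omega
        · have := hge i hi; omega
      · intro i hi
        rcases List.mem_cons.1 hi with rfl | hi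
        · omega
        · rcases List.mem_cons.1 hi with rfl | hi
          · omega
          · have := hge i hi; omega
      · intro x hmem k h1 h2
        rcases h1.eq_or_lt with rfl | h1
        · cases b <;> simp_all [alternatingInter]
        · refine hx x ?_ k h1 (by omega)
          cases b
          · exact hmem.2.2
          · exact hmem.2.2

/-- Rosenthal's dichotomy for sequences of pairs of sets: a sequence of pairs without a convergent
subsequence has an independent subsequence. -/
theorem exists_independent_subsequence (A B : ℕ → Set S)
    (h : ∀ m : ℕ → ℕ, StrictMono m →
      ∃ x, (∃ᶠ n in atTop, x ∈ A (m n)) ∧ ∃ᶠ n in atTop, x ∈ B (m n)) :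
    ∃ m : ℕ → ℕ, StrictMono m ∧ ∀ P M : Finset ℕ, Disjoint P M →
      ((⋂ n ∈ P, A (m n)) ∩ ⋂ n ∈ M, B (m n)).Nonempty := by
  obtain ⟨m, hm, hF | hF⟩ := exists_strictMono_forall_notMem_or_forall_exists_mem
    {l | ¬ (alternatingInter A B true l).Nonempty}
  · refine ⟨fun k => m (2 * k + 1), fun i j hij => hm (by omega), fun P M hPM => ?_⟩
    obtain ⟨l, hl, -, hx⟩ := exists_list_alternatingInter_subset A B m (fun k => k ∈ P)
      ((P ∪ M).sup id + 1) 0 true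
    obtain ⟨x, hxm⟩ : (alternatingInter A B true (l.map m)).Nonempty := by
      simpa using hF l hl
    have hlt : ∀ k ∈ P ∪ M, k < 0 + ((P ∪ M).sup id + 1) := fun k hk => by
      have : k ≤ (P ∪ M).sup id := Finset.le_sup (f := id) hk
      omega
    refine ⟨x, Set.mem_iInter₂.2 fun k hk => ?_, Set.mem_iInter₂.2 fun k hk => ?_⟩
    · exact (hx x hxm k k.zero_le (hlt k (Finset.mem_union_left _ hk))).1 hk
    · exact (hx x hxm k k.zero_le (hlt k (Finset.mem_union_right _ hk))).2
        (Finset.disjoint_right.1 hPM hk)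
  · exfalso
    obtain ⟨x, hA, hB⟩ := h m hm
    obtain ⟨i, hi, hix⟩ := extraction_forall_of_frequently
      (P := fun j n => if (j % 2 = 0 ↔ true = true) then x ∈ A (m n) else x ∈ B (m n))
      (fun j => by split_ifs <;> assumption)
    obtain ⟨k, hk⟩ := hF i hi
    exact hk ⟨x, mem_alternatingInter_map_range k true (m ∘ i) hix⟩

/-- Diagonalisation: if for each `q` every subsequence has a further subsequence along which no
point is frequently in `A q` and frequently in `B q`, then one subsequence does for all `q`. -/
theorem exists_common_convergent_subsequence {ι : Type*} [Countable ι] (A B : ι → ℕ → Set S)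
    (h : ∀ (q : ι) (m : ℕ → ℕ), StrictMono m → ∃ φ : ℕ → ℕ, StrictMono φ ∧
      ∀ x, ¬ ((∃ᶠ n in atTop, x ∈ A q (m (φ n))) ∧ ∃ᶠ n in atTop, x ∈ B q (m (φ n)))) :
    ∃ m : ℕ → ℕ, StrictMono m ∧
      ∀ q x, ¬ ((∃ᶠ n in atTop, x ∈ A q (m n)) ∧ ∃ᶠ n in atTop, x ∈ B q (m n)) := by
  rcases isEmpty_or_nonempty ι with hι | hι
  · exact ⟨id, strictMono_id, fun q => hι.elim q⟩
  obtain ⟨e, he⟩ := exists_surjective_nat ι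
  choose φ hφ hφx using h
  let c : ℕ → {m : ℕ → ℕ // StrictMono m} := fun n => Nat.rec ⟨id, strictMono_id⟩
    (fun k m => ⟨m.1 ∘ φ (e k) m.1 m.2, m.2.comp (hφ _ _ _)⟩) n
  have hrange : ∀ k d, ∃ ψ : ℕ → ℕ, (c (k + d)).1 = (c k).1 ∘ ψ := by
    intro k d
    induction d with
    | zero => exact ⟨id, rfl⟩
    | succ d ih =>
      obtain ⟨ψ, hψ⟩ := ih
      refine ⟨ψ ∘ φ (e (k + d)) (c (k + d)).1 (c (k + d)).2, ?_⟩
      rw [← Function.comp_assoc, ← hψ]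
      rfl
  obtain ⟨m, hm, hmem⟩ := extraction_forall_of_frequently
    (P := fun k n => n ∈ Set.range (c k).1) (fun k => by
      rw [Nat.frequently_atTop_iff_infinite]
      exact Set.infinite_range_of_injective (c k).2.injective)
  refine ⟨m, hm, fun q x => ?_⟩
  obtain ⟨k, rfl⟩ := he q
  have transfer : ∀ D : ℕ → Set S, (∃ᶠ n in atTop, x ∈ D (m n)) →
      ∃ᶠ n in atTop, x ∈ D ((c k).1 (φ (e k) (c k).1 (c k).2 n)) := by
    intro D hD
    rw [frequently_atTop] at hD ⊢
    intro N
    -- The first bound puts `m n` in the range of `c (k + 1)`; the second makes its index there at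
    -- least `N`.
    obtain ⟨n, hn, hxn⟩ := hD (max (k + 1) ((c (k + 1)).1 N))
    obtain ⟨ψ, hψ⟩ := hrange (k + 1) (n - (k + 1))
    rw [Nat.add_sub_cancel' (le_trans (le_max_left _ _) hn)] at hψ
    obtain ⟨j, hj⟩ := hmem n
    have hj' : (c (k + 1)).1 (ψ j) = m n := by rw [← hj, hψ]; rfl
    refine ⟨ψ j, ?_, ?_⟩
    · rw [← (c (k + 1)).2.le_iff_le, hj']
      exact le_trans (le_trans (le_max_right _ _) hn) (hm.le_apply)
    · have h3 : (c k).1 (φ (e k) (c k).1 (c k).2 (ψ j)) = m n := hj'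
      rwa [h3]
  exact fun ⟨h1, h2⟩ => hφx (e k) (c k).1 (c k).2 x ⟨transfer _ h1, transfer _ h2⟩

end Rosenthal

/-! ### Convergence of translations and tameness -/

section Systems

variable {G X Y : Type*} [Group G]

/-- A sequence in a compact metric space converges if its distances to the points of a dense
sequence do not oscillate. -/
theorem exists_tendsto_of_forall_not_frequently [MetricSpace Y] [CompactSpace Y] {d : ℕ → Y}
    (hd : DenseRange d) (u : ℕ → Y)
    (h : ∀ (i : ℕ) (a b : ℚ), a < b →
      ¬ ((∃ᶠ n in atTop, dist (u n) (d i) < a) ∧ ∃ᶠ n in atTop, (b : ℝ) < dist (u n) (d i))) :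
    ∃ y, Tendsto u atTop (𝓝 y) := by
  obtain ⟨y, -, φ, hφ, hy⟩ := isCompact_univ.tendsto_subseq (x := u) fun n => Set.mem_univ _
  refine ⟨y, ?_⟩
  by_contra hnot
  rw [Metric.tendsto_atTop] at hnot
  push Not at hnot
  obtain ⟨ε, hε, hfar⟩ := hnot
  obtain ⟨i, hi⟩ := hd.exists_dist_lt y (show (0 : ℝ) < ε / 4 by positivity)
  -- Terms near `y` are eventually within `a` of `d i`; terms at distance at least `ε` from `y` stay
  -- more than `3 * ε / 4 > b` away.
  obtain ⟨a, ha1, ha2⟩ := exists_rat_btwn (show ε / 4 < ε / 2 by linarith)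
  obtain ⟨b, hb1, hb2⟩ := exists_rat_btwn (show ε / 2 < 3 * ε / 4 by linarith)
  refine h i a b (by exact_mod_cast ha2.trans hb1) ⟨?_, ?_⟩
  · have h1 : Tendsto (fun n => dist ((u ∘ φ) n) (d i)) atTop (𝓝 (dist y (d i))) :=
      hy.dist tendsto_const_nhds
    have h2 : ∀ᶠ n in atTop, dist ((u ∘ φ) n) (d i) < a :=
      h1.eventually_lt_const (hi.trans ha1)
    exact hφ.tendsto_atTop.frequently h2.frequently
  · rw [frequently_atTop]
    intro N
    obtain ⟨n, hn, hdist⟩ := hfar N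
    refine ⟨n, hn, ?_⟩
    have := dist_triangle (u n) (d i) y
    rw [dist_comm (d i) y] at this
    linarith

/-- In a tame metric system every sequence of translations has a pointwise convergent
subsequence. -/
theorem IsTame.exists_tendsto_subsequence [MetricSpace Y] [CompactSpace Y] [MulAction G Y]
    (hY : IsTame G Y) (g : ℕ → G) :
    ∃ (φ : ℕ → ℕ) (p : Y → Y), StrictMono φ ∧
      ∀ y, Tendsto (fun n => g (φ n) • y) atTop (𝓝 (p y)) := by
  rcases isEmpty_or_nonempty Y with hne | hne
  · exact ⟨id, id, strictMono_id, fun y => hne.elim y⟩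
  let d : ℕ → Y := TopologicalSpace.denseSeq Y
  let A : ℕ × {q : ℚ × ℚ // q.1 < q.2} → ℕ → Set Y :=
    fun q n => {y | dist (g n • y) (d q.1) < (q.2.1.1 : ℝ)}
  let B : ℕ × {q : ℚ × ℚ // q.1 < q.2} → ℕ → Set Y :=
    fun q n => {y | (q.2.1.2 : ℝ) < dist (g n • y) (d q.1)}
  obtain ⟨φ, hφ, hconv⟩ := exists_common_convergent_subsequence A B (by
    intro q m hm
    by_contra hcon
    push Not at hcon
    obtain ⟨ψ, hψ, hind⟩ := exists_independent_subsequence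
      (fun n => A q (m n)) (fun n => B q (m n)) hcon
    refine hY ⟨fun y => dist y (d q.1), by fun_prop⟩
      ⟨fun n y => dist (g (m (ψ n)) • y) (d q.1), fun n => ⟨g (m (ψ n)), rfl⟩,
        q.2.1.1, q.2.1.2, by exact_mod_cast q.2.2, hind⟩)
  have hex : ∀ y, ∃ z, Tendsto (fun n => g (φ n) • y) atTop (𝓝 z) := fun y =>
    exists_tendsto_of_forall_not_frequently (TopologicalSpace.denseRange_denseSeq Y) _
      fun i a b hab => hconv (i, ⟨(a, b), hab⟩) y
  choose p hp using hex
  exact ⟨φ, p, hφ, hp⟩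

/-- In an equicontinuous compact metric system every sequence of translations has a subsequence
converging pointwise to an injective map. -/
theorem IsEquicontinuousSystem.exists_tendsto_subsequence [MetricSpace Y] [CompactSpace Y]
    [MulAction G Y] (hY : IsEquicontinuousSystem G Y) (g : ℕ → G) :
    ∃ (φ : ℕ → ℕ) (p : Y → Y), StrictMono φ ∧
      (∀ y, Tendsto (fun n => g (φ n) • y) atTop (𝓝 (p y))) ∧ Function.Injective p := by
  have hcont : ∀ a : G, Continuous fun y : Y => a • y := fun a => hY.continuous a
  let T : G → BoundedContinuousFunction Y Y := fun a =>
    BoundedContinuousFunction.mkOfCompact ⟨fun y => a • y, hcont a⟩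
  have hcompact : IsCompact (closure (Set.range T)) := by
    refine BoundedContinuousFunction.arzela_ascoli Set.univ isCompact_univ _
      (fun _ _ _ => Set.mem_univ _) ?_
    intro y V hV
    filter_upwards [hY y V hV] with z hz
    rintro ⟨_, a, rfl⟩
    exact hz a
  obtain ⟨p, -, φ, hφ, hp⟩ := hcompact.tendsto_subseq (x := fun n => T (g n))
    fun n => subset_closure ⟨g n, rfl⟩
  have hpt : ∀ y, Tendsto (fun n => g (φ n) • y) atTop (𝓝 (p y)) := fun y =>
    ((continuous_eval_const y).tendsto p).comp hp
  refine ⟨φ, p, hφ, hpt, fun y z hyz => ?_⟩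
  have hunif := CompactSpace.uniformEquicontinuous_of_equicontinuous hY
  refine eq_of_forall_dist_le fun ε hε => ?_
  obtain ⟨δ, hδ, hsmall⟩ := Metric.uniformEquicontinuous_iff.1 hunif ε hε
  have hlim : Tendsto (fun n => dist (g (φ n) • y) (g (φ n) • z)) atTop (𝓝 0) := by
    have := (hpt y).dist (hpt z)
    rwa [hyz, dist_self] at this
  obtain ⟨n, hn⟩ := (hlim.eventually_lt_const hδ).exists
  -- Equicontinuity covers the inverse translations, so points brought close together were already
  -- close.
  have := hsmall _ _ hn (g (φ n))⁻¹
  simpa using this.le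

/-- Weakening to closed half-lines lets the finite intersection property realise infinite patterns.
-/
theorem IsIndependentSeq.exists_forall_le_and_ge [TopologicalSpace X] [CompactSpace X]
    {f : ℕ → X → ℝ} (hf : ∀ n, Continuous (f n)) (hind : IsIndependentSeq f) :
    ∃ a b : ℝ, a < b ∧ ∀ S : Set ℕ, ∃ x, (∀ n ∈ S, f n x ≤ a) ∧ ∀ n ∉ S, b ≤ f n x := by
  classical
  obtain ⟨a, b, hab, h⟩ := hind
  refine ⟨a, b, hab, fun S => ?_⟩
  let C : ℕ → Set X := fun n => if n ∈ S then f n ⁻¹' Set.Iic a else f n ⁻¹' Set.Ici b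
  have hC : ∀ n, IsClosed (C n) := fun n => by
    by_cases hn : n ∈ S
    · simpa only [C, if_pos hn] using isClosed_Iic.preimage (hf n)
    · simpa only [C, if_neg hn] using isClosed_Ici.preimage (hf n)
  obtain ⟨x, hx⟩ := CompactSpace.iInter_nonempty hC fun s => by
    obtain ⟨x, hx1, hx2⟩ := h (s.filter (· ∈ S)) (s.filter (· ∉ S))
      (Finset.disjoint_filter_filter_not _ _ _)
    refine ⟨x, Set.mem_iInter₂.2 fun n hn => ?_⟩
    by_cases hnS : n ∈ S
    · have : f n x < a := Set.mem_iInter₂.1 hx1 n (Finset.mem_filter.2 ⟨hn, hnS⟩)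
      simpa [C, hnS] using this.le
    · have : b < f n x := Set.mem_iInter₂.1 hx2 n (Finset.mem_filter.2 ⟨hn, hnS⟩)
      simpa [C, hnS] using this.le
  refine ⟨x, fun n hn => ?_, fun n hn => ?_⟩
  · simpa [C, hn] using Set.mem_iInter.1 hx n
  · simpa [C, hn] using Set.mem_iInter.1 hx n

/-- If `u` maps under `π` to a convergent sequence whose limit has at most one preimage, then `u`
converges. -/
theorem exists_tendsto_of_subsingleton_fibre [MetricSpace X] [CompactSpace X] [TopologicalSpace Y]
    [T2Space Y] {π : X → Y} (hπ : Continuous π) {u : ℕ → X} {y : Y}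
    (hu : Tendsto (fun n => π (u n)) atTop (𝓝 y)) (hy : (π ⁻¹' {y}).Subsingleton) :
    ∃ x, Tendsto u atTop (𝓝 x) := by
  have hlim : ∀ (φ : ℕ → ℕ) (x : X), Tendsto φ atTop atTop → Tendsto (u ∘ φ) atTop (𝓝 x) →
      π x = y := fun φ x hφ hx =>
    tendsto_nhds_unique ((hπ.tendsto x).comp hx) (hu.comp hφ)
  obtain ⟨x, -, φ, hφ, hx⟩ := isCompact_univ.tendsto_subseq (x := u) fun n => Set.mem_univ _
  refine ⟨x, tendsto_of_subseq_tendsto fun ns hns => ?_⟩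
  obtain ⟨z, -, ψ, hψ, hz⟩ := isCompact_univ.tendsto_subseq (x := u ∘ ns) fun n => Set.mem_univ _
  have hzx : z = x := hy (hlim (ns ∘ ψ) z (hns.comp hψ.tendsto_atTop) hz)
    (hlim φ x hφ.tendsto_atTop hx)
  exact ⟨ψ, hzx ▸ hz⟩

/-- If `π : X → Y` has countable fibres, all but countably many of which have at most one point,
and every sequence of translations of `Y` has a subsequence converging pointwise to a map with
countable fibres, then `X` is tame. -/
theorem IsGMap.isTame_of_countable_fibres [MetricSpace X] [CompactSpace X] [MulAction G X]
    [ContinuousConstSMul G X] [MetricSpace Y] [MulAction G Y] {π : X → Y} (hπ : IsGMap G π)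
    (hfib : ∀ y, (π ⁻¹' {y}).Countable) (hmult : {y | ¬ (π ⁻¹' {y}).Subsingleton}.Countable)
    (hY : ∀ g : ℕ → G, ∃ (φ : ℕ → ℕ) (p : Y → Y), StrictMono φ ∧
      (∀ y, Tendsto (fun n => g (φ n) • y) atTop (𝓝 (p y))) ∧ ∀ y, (p ⁻¹' {y}).Countable) :
    IsTame G X := by
  rintro f ⟨F, hF, hind⟩
  choose g hg using hF
  have hFg : ∀ n x, F n x = f (g n • x) := fun n x => (congrFun (hg n) x).symm
  obtain ⟨a, b, hab, hsep⟩ := hind.exists_forall_le_and_ge fun n => by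
    rw [← hg n]; exact f.continuous.comp (continuous_const_smul (g n))
  obtain ⟨φ, p, hφ, hp, hpfib⟩ := hY g
  -- Residues 0 and 1 mod 3 force low and high values infinitely often; residue 2 records `T`.
  let S : Set ℕ → Set ℕ := fun T => {k | k % 3 = 0 ∨ (k % 3 = 2 ∧ k / 3 ∈ T)}
  choose x hxle hxge using fun T => hsep (φ '' S T)
  have hle : ∀ T k, k ∈ S T → f (g (φ k) • x T) ≤ a := fun T k hk => by
    rw [← hFg]; exact hxle T _ ⟨k, hk, rfl⟩
  have hge : ∀ T k, k ∉ S T → b ≤ f (g (φ k) • x T) := fun T k hk => by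
    rw [← hFg]
    refine hxge T _ fun ⟨j, hj, hjk⟩ => hk ?_
    rwa [← hφ.injective hjk]
  have hS : ∀ T k, 3 * k + 2 ∈ S T ↔ k ∈ T := fun T k => by
    have h1 : (3 * k + 2) % 3 = 2 := by omega
    have h2 : (3 * k + 2) / 3 = k := by omega
    simp [S, h1, h2]
  have hinj : Function.Injective x := by
    intro T T' hTT
    ext k
    rw [← hS T, ← hS T']
    constructor <;> intro h1 <;> by_contra h2
    · have h3 := hle T _ h1
      have h4 := hge T' _ h2
      rw [hTT] at h3
      linarith
    · have h3 := hge T _ h2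
      have h4 := hle T' _ h1
      rw [hTT] at h3
      linarith
  have hmem : ∀ T, x T ∈ π ⁻¹' (p ⁻¹' {y | ¬ (π ⁻¹' {y}).Subsingleton}) := by
    intro T hsub
    obtain ⟨z, hz⟩ := exists_tendsto_of_subsingleton_fibre (u := fun n => g (φ n) • x T)
      hπ.continuous (by simpa only [hπ.map_smul] using hp (π (x T))) hsub
    have hfz : Tendsto (fun n => f (g (φ n) • x T)) atTop (𝓝 (f z)) :=
      (f.continuous.tendsto z).comp hz
    have h0 : Tendsto (fun k : ℕ => 3 * k) atTop atTop :=
      tendsto_atTop_mono (fun k => show k ≤ 3 * k by omega) tendsto_id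
    have h1 : Tendsto (fun k : ℕ => 3 * k + 1) atTop atTop :=
      tendsto_atTop_mono (fun k => show k ≤ 3 * k + 1 by omega) tendsto_id
    have hza : f z ≤ a := le_of_tendsto' (hfz.comp h0) fun k =>
      hle T _ (Or.inl (Nat.mul_mod_right 3 k))
    have hzb : b ≤ f z := ge_of_tendsto' (hfz.comp h1) fun k =>
      hge T _ fun h => by simp only [S, Set.mem_ofPred_eq] at h; omega
    linarith
  have hcount : (Set.range x).Countable := by
    refine Set.Countable.mono (Set.range_subset_iff.2 hmem) ?_
    rw [← Set.biUnion_preimage_singleton]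
    refine Set.Countable.biUnion ?_ fun y _ => hfib y
    rw [← Set.biUnion_preimage_singleton]
    exact hmult.biUnion fun y _ => hpfib y
  have : Countable (Set ℕ) := by
    have := hcount.to_subtype
    exact (Set.rangeFactorization_injective.2 hinj).countable
  obtain ⟨e, he⟩ := exists_surjective_nat (Set ℕ)
  exact Function.cantor_surjective e he

theorem IsStronglyAlmostOneOneExtension.isTame [MetricSpace X] [CompactSpace X] [MulAction G X]
    [ContinuousConstSMul G X] [MetricSpace Y] [CompactSpace Y] [MulAction G Y] {π : X → Y}
    (hπ : IsStronglyAlmostOneOneExtension G π) (hY : IsTame G Y)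
    (hfib : ∀ p ∈ envelopingSemigroup G Y, ∀ y : Y, (p ⁻¹' {y}).Countable) : IsTame G X := by
  have hsub : ∀ y, ¬ (π ⁻¹' {y}).Subsingleton → π ⁻¹' {y} ⊆ (singletonFibrePart π)ᶜ := by
    rintro _ hy x rfl hx
    obtain ⟨z, hz⟩ := Set.encard_eq_one.1 hx
    exact hy (hz ▸ Set.subsingleton_singleton)
  refine hπ.isGMap.isTame_of_countable_fibres (fun y => ?_) ?_ fun g => ?_
  · by_cases hy : (π ⁻¹' {y}).Subsingleton
    · exact hy.countable
    · exact hπ.countable.mono (hsub y hy)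
  · refine (hπ.countable.image π).mono fun y hy => ?_
    obtain ⟨x, rfl⟩ := hπ.surjective y
    exact ⟨x, hsub _ hy rfl, rfl⟩
  · obtain ⟨φ, p, hφ, hp⟩ := hY.exists_tendsto_subsequence g
    exact ⟨φ, p, hφ, hp, hfib p (mem_closure_of_tendsto (tendsto_pi_nhds.2 hp)
      (Eventually.of_forall fun n => ⟨g (φ n), rfl⟩))⟩

theorem IsStrongAlmostOneOneEquivalence.isTame [MetricSpace X] [CompactSpace X] [MulAction G X]
    [ContinuousConstSMul G X] [MetricSpace Y] [CompactSpace Y] [MulAction G Y] {π : X → Y}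
    (hπ : IsStrongAlmostOneOneEquivalence G π) (hY : IsEquicontinuousSystem G Y) :
    IsTame G X := by
  obtain ⟨X₁, Y₁, hX₁, -, hbij⟩ := hπ.exists_countable
  refine hπ.isGMap.isTame_of_countable_fibres (fun y => ?_) ?_ fun g => ?_
  -- Injectivity off `X₁` leaves each fibre at most one point outside `X₁`.
  · have h1 : (π ⁻¹' {y} ∩ X₁ᶜ).Subsingleton := fun u hu v hv =>
      hbij.injOn hu.2 hv.2 (hu.1.trans hv.1.symm)
    refine (hX₁.union h1.countable).mono fun x hx => ?_
    by_cases hxX : x ∈ X₁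
    · exact Or.inl hxX
    · exact Or.inr ⟨hx, hxX⟩
  · refine (hX₁.image π).mono fun y hy => ?_
    by_contra hyX
    exact hy fun u hu v hv => hbij.injOn (fun h => hyX ⟨u, h, hu⟩) (fun h => hyX ⟨v, h, hv⟩)
      (Eq.trans hu (Eq.symm hv))
  · obtain ⟨φ, p, hφ, hp, hinj⟩ := hY.exists_tendsto_subsequence g
    exact ⟨φ, p, hφ, hp, fun y => (Set.subsingleton_singleton.preimage hinj).countable⟩

end Systems

end TameSystems

theorem theorem6p14 {G X Y : Type*} [Group G] [TopologicalSpace G] [IsTopologicalGroup G]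
    [MetricSpace X] [CompactSpace X] [MulAction G X] [ContinuousSMul G X]
    [MetricSpace Y] [CompactSpace Y] [MulAction G Y] [ContinuousSMul G Y] :
    (∀ π : X → Y, TameSystems.IsStronglyAlmostOneOneExtension G π →
      TameSystems.IsTame G Y →
      (∀ p ∈ TameSystems.envelopingSemigroup G Y, ∀ y : Y, (p ⁻¹' {y}).Countable) →
      TameSystems.IsTame G X) ∧
    (∀ π : X → Y, TameSystems.IsStrongAlmostOneOneEquivalence G π →
      TameSystems.IsEquicontinuousSystem G Y →
      TameSystems.IsTame G X) :=
  ⟨fun _ hπ hY hfib => hπ.isTame hY hfib, fun _ hπ hY => hπ.isTame hY⟩
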